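/- **Setting.** Let $P(F,U,\epsilon)$ be a prior over structural causal models: $F$ is a tuple of causal functions, $U=(U_1,U_2,\dots)$ are latent confounders and $\epsilon=(\epsilon_1,\epsilon_2,\dots)$ exogenous noise, independent across instances given $(F,U)$, with $\epsilon_i$ having a law that depends on $(F,U_i)$. The observed variables $V_i$ of instance $i$ are computed in causal order from $F$, $U_i$, $\epsilon_i$, and have a conditional density $P(V_i\mid F,U_i)$, so that $P(V\mid F,U)=\prod_{i=1}^n P(V_i\mid F,U_i)$ for $n$ instances. Let $Q$ be a real-valued causal estimand of the two sets of counterfactual outcomes under $do(V'=v')$ and $do(V'=v'')$, and let $n\ge 1$, $k\ge 2$, $\lambda,t\in\mathbb R$, $0<p<1$. For data $V^*$ of $n$ instances generated by $(F^*,U^*)$ from noise $\epsilon^*$, let $(\hat F^1,\hat U^1,\hat F^2,\hat U^2)$ maximize $$\mathcal L=\log P(V^*\mid F^1,U^1)+\log P(V^*\mid F^2,U^2)+\lambda\,|Q^1-Q^2|,$$ where $Q^j$ is the effect under $(F^j,U^j,\epsilon^*)$, and let $\Delta\hat Q=|\hat Q^1-\hat Q^2|$ be the gap at the maximizer (assumed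 jointly measurable in $(F^*,U^*)$ and $\epsilon^*$). Let $E_n=\mathbb E_{V^*,n}\Delta\hat Q$ be its expectation over $V^*\sim P(V\mid F^*,U^*)$ with $n$ instances, and $E_\infty=\mathbb E_{V^*,\infty}\Delta\hat Q=\lim_{n\to\infty}E_n$; both are functions of $(F^*,U^*)$, assumed to exist and be finite for almost every $(F^*,U^*)$. **Algorithm 1.** Draw $(F^*,U^*)$ from the prior; given it, draw $k$ independent data sets of $n$ instances and compute their gaps $D=(\Delta\hat Q_1,\dots,\Delta\hat Q_k)$, with sample mean $\hat\mu$ and sample variance $\hat\sigma^2=\frac1{k-1}\sum_i(\hat\mu-\Delta\hat Q_i)^2$. Return TRUE if and only if $\tau<p$, where $\tau=\Phi\big((\hat\mu-t)\sqrt k/\hat\sigma\big)$, $\Phi$ is the standard normal distribution function, and $\tau=\mathbf 1[\hat\mu>t]$ if $\hat\sigma=0$. **Theorem 4.4.** Assume that for almost every $(F^*,U^*)$, $E_N\ge E_\infty$ for all $N\ge1$ (Assumption 1). 1. (Given the simulations.) Almost surely, if Algorithm 1 returns TRUE, and if the normal approximation of the error of the sample mean of the $k$ trials is sufficiently tight,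 namely $$\big|P(\hat\mu-E_n<x\mid D)-N(0,\hat\sigma^2/k)\big((-\infty,x)\big)\big|<p-\tau\quad\text{for all }x\in\mathbb R,$$ then $P(E_\infty>t\mid D)<p$. 2. (Over repeated simulations.) For almost every $(F^*,U^*)$ with $E_\infty>t$ and every $\delta$: if the studentized mean of the $k$ trials satisfies the central limit approximation within $\delta$, namely $$\big|P\big((\hat\mu-E_n)\sqrt k\le x\,\hat\sigma\mid F^*,U^*\big)-\Phi(x)\big|<\delta\quad\text{for all }x\in\mathbb R,$$ then Algorithm 1 returns TRUE with probability less than $p+\delta$ given $(F^*,U^*)$. -/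

import Mathlib

open MeasureTheory ProbabilityTheory Filter
open scoped NNReal ENNReal Topology

noncomputable section

/-- Finite product of Markov kernels: coordinates are drawn independently given `a`. -/
def piKernel {ι α β : Type*} [Fintype ι] [MeasurableSpace α] [MeasurableSpace β]
    (κ : ι → Kernel α β) [∀ i, IsMarkovKernel (κ i)] : Kernel α (ι → β) where
  toFun a := Measure.pi (fun i => κ i a)
  measurable' := by
    have hp : ∀ a, IsProbabilityMeasure (Measure.pi (fun i => κ i a)) := fun a => inferInstance
    refine Measurable.measure_of_isPiSystem_of_isProbabilityMeasure generateFrom_pi.symm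
      isPiSystem_pi ?_
    rintro s ⟨t, ht, rfl⟩
    simp only [Measure.pi_pi]
    exact Finset.measurable_prod _ fun i _ =>
      Kernel.measurable_coe (κ i) (ht i (Set.mem_univ i))

instance {ι α β : Type*} [Fintype ι] [MeasurableSpace α] [MeasurableSpace β]
    (κ : ι → Kernel α β) [∀ i, IsMarkovKernel (κ i)] : IsMarkovKernel (piKernel κ) :=
  ⟨fun a => by
    change IsProbabilityMeasure (Measure.pi (fun i => κ i a))
    infer_instance⟩

/-- A Bayesian structural causal model, that is, a prior `P(F, U, ε)`.

* `𝓕` is the space of (parameters of) tuples of causal functions, `𝒰` the space of values of the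
  latent confounders of one instance; the confounders are a sequence `U = (U₀, U₁, …)`, of which
  a data set of `n` instances uses the first `n` terms.
* There are `m` observed variables per instance, in causal order; the `j`-th takes values in `X j`
  and is computed from its predecessors, the latent confounders and its own exogenous noise,
  which takes values in `E j`.
* Given `(F, U)` the noise vectors of distinct instances are independent, the one of
  instance `i` having law `noise (F, U i)`. -/
structure BayesianSCM {m : ℕ} (𝓕 𝒰 : Type*) (X E : Fin m → Type*)
    [MeasurableSpace 𝓕] [MeasurableSpace 𝒰] [∀ j, MeasurableSpace (X j)]
    [∀ j, MeasurableSpace (E j)] where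
  /-- the prior law `P(F, U)` -/
  prior : Measure (𝓕 × (ℕ → 𝒰))
  isProbabilityMeasure_prior : IsProbabilityMeasure prior
  /-- the law of the exogenous noise of one instance -/
  noise : Kernel (𝓕 × 𝒰) (∀ j, E j)
  isMarkovKernel_noise : IsMarkovKernel noise
  /-- the structural functions -/
  fn : 𝓕 → (j : Fin m) → ((i : {i : Fin m // i < j}) → X i) → 𝒰 → E j → X j
  measurable_fn : ∀ j, Measurable
    (fun q : 𝓕 × ((i : {i : Fin m // i < j}) → X i) × 𝒰 × E j => fn q.1 j q.2.1 q.2.2.1 q.2.2.2)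

/-- A causal question: the set `targets` of intervened variables, the two sets of values
`val₁`, `val₂` they are set to, and the estimand, which for each number `n` of instances maps two
sets of counterfactual outcomes to a real number. -/
structure CausalQuery {m : ℕ} (X : Fin m → Type*) where
  targets : Finset (Fin m)
  val₁ : (j : targets) → X j
  val₂ : (j : targets) → X j
  Q : (n : ℕ) → (Fin n → (j : Fin m) → X j) → (Fin n → (j : Fin m) → X j) → ℝ

/-- The intervention `do(V' = x)` on the variables in `S`. -/
def doIntervention {m : ℕ} {X : Fin m → Type*} (S : Finset (Fin m)) (x : (j : S) → X j) :
    (j : Fin m) → Option (X j) :=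
  fun j => if h : j ∈ S then some (x ⟨j, h⟩) else none

/-- A particle for `n` instances: causal functions and `n` latent confounders. -/
abbrev Particle (𝓕 𝒰 : Type*) (n : ℕ) := 𝓕 × (Fin n → 𝒰)

/-- A rule that assigns to each simulated data set of `n` instances (and the exogenous noise that
generated it) two particles. -/
abbrev ParticleRule {m : ℕ} (𝓕 𝒰 : Type*) (X E : Fin m → Type*) :=
  (n : ℕ) → (Fin n → (j : Fin m) → X j) → (Fin n → (j : Fin m) → E j) →
    Particle 𝓕 𝒰 n × Particle 𝓕 𝒰 n

/-- `(1/k) ∑ᵢ Dᵢ` -/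
def sampleMean {k : ℕ} (D : Fin k → ℝ) : ℝ := (1 / (k : ℝ)) * ∑ i, D i

/-- `(1/(k-1)) ∑ᵢ (mean - Dᵢ)²` -/
def sampleVariance {k : ℕ} (D : Fin k → ℝ) : ℝ :=
  (1 / ((k : ℝ) - 1)) * ∑ i, (sampleMean D - D i) ^ 2

/-- The sample standard deviation. -/
def sampleStd {k : ℕ} (D : Fin k → ℝ) : ℝ := √(sampleVariance D)

/-- The standard normal distribution function. -/
def stdNormalCDF (x : ℝ) : ℝ := cdf (gaussianReal 0 1) x

/-- `Φ((mean - t) √k / std)`, the number that is compared with `p`.  For `std = 0` it is the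
limiting value, the probability that a point mass at the sample mean exceeds `t`. -/
def testValue {k : ℕ} (t : ℝ) (D : Fin k → ℝ) : ℝ :=
  if sampleStd D = 0 then (if t < sampleMean D then 1 else 0)
  else stdNormalCDF ((sampleMean D - t) * √(k : ℝ) / sampleStd D)

namespace BayesianSCM

variable {m : ℕ} {𝓕 𝒰 : Type*} {X E : Fin m → Type*}
  [MeasurableSpace 𝓕] [MeasurableSpace 𝒰] [∀ j, MeasurableSpace (X j)]
  [∀ j, MeasurableSpace (E j)]

instance (M : BayesianSCM 𝓕 𝒰 X E) : IsProbabilityMeasure M.prior := M.isProbabilityMeasure_prior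

instance (M : BayesianSCM 𝓕 𝒰 X E) : IsMarkovKernel M.noise := M.isMarkovKernel_noise

/-- The variables of one instance under the intervention `iv` (`none` means that the variable is
left to its structural function). -/
def solve (M : BayesianSCM 𝓕 𝒰 X E) (F : 𝓕) (iv : (j : Fin m) → Option (X j)) (u : 𝒰)
    (e : (j : Fin m) → E j) (j : Fin m) : X j :=
  match iv j with
  | some x => x
  | none => M.fn F j (fun i => M.solve F iv u e i.1) u (e j)
termination_by j
decreasing_by exact i.2

/-- The observed variables of one instance. -/
def observe (M : BayesianSCM 𝓕 𝒰 X E) (F : 𝓕) (u : 𝒰) (e : (j : Fin m) → E j) :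
    (j : Fin m) → X j :=
  M.solve F (fun _ => none) u e

/-- A version of the conditional density `P(Vᵢ | F, Uᵢ)` of one instance, with respect to a fixed
reference measure on the observation space. -/
structure Likelihood (M : BayesianSCM 𝓕 𝒰 X E) where
  ref : Measure ((j : Fin m) → X j)
  sigmaFinite_ref : SigmaFinite ref
  dens : 𝓕 → 𝒰 → ((j : Fin m) → X j) → ℝ≥0
  measurable_dens : ∀ F u, Measurable (dens F u)
  map_observe : ∀ F u, (M.noise (F, u)).map (M.observe F u) =
    ref.withDensity (fun v => (dens F u v : ℝ≥0∞))

/-- The log likelihood `log P(V | F, U)` of `n` instances, with `log 0 = -∞`. -/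
def logLik {M : BayesianSCM 𝓕 𝒰 X E} (L : M.Likelihood) {n : ℕ} (P : Particle 𝓕 𝒰 n)
    (V : Fin n → (j : Fin m) → X j) : EReal :=
  ENNReal.log ((∏ i, L.dens P.1 (P.2 i) (V i) : ℝ≥0) : ℝ≥0∞)

/-- The causal effect of the model `(F, U, ε)`: the estimand applied to the two sets
of counterfactual outcomes. -/
def effect (M : BayesianSCM 𝓕 𝒰 X E) (q : CausalQuery X) {n : ℕ} (P : Particle 𝓕 𝒰 n)
    (e : Fin n → (j : Fin m) → E j) : ℝ :=
  q.Q n (fun i => M.solve P.1 (doIntervention q.targets q.val₁) (P.2 i) (e i))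
    (fun i => M.solve P.1 (doIntervention q.targets q.val₂) (P.2 i) (e i))

/-- `ΔQ = |Q¹ - Q²|` for a pair of particles. -/
def effectGap (M : BayesianSCM 𝓕 𝒰 X E) (q : CausalQuery X) {n : ℕ}
    (P : Particle 𝓕 𝒰 n × Particle 𝓕 𝒰 n) (e : Fin n → (j : Fin m) → E j) : ℝ :=
  |M.effect q P.1 e - M.effect q P.2 e|

/-- The objective `log P(V | F¹, U¹) + log P(V | F², U²) + lam * ΔQ`. -/
def objective {M : BayesianSCM 𝓕 𝒰 X E} (L : M.Likelihood) (q : CausalQuery X) (lam : ℝ) {n : ℕ}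
    (P : Particle 𝓕 𝒰 n × Particle 𝓕 𝒰 n) (V : Fin n → (j : Fin m) → X j)
    (e : Fin n → (j : Fin m) → E j) : EReal :=
  logLik L P.1 V + logLik L P.2 V + ((lam * M.effectGap q P e : ℝ) : EReal)

/-- The law of the exogenous noise of `n` instances, given `(F*, U*)`. -/
def noiseLaw (M : BayesianSCM 𝓕 𝒰 X E) (n : ℕ) :
    Kernel (𝓕 × (ℕ → 𝒰)) (Fin n → (j : Fin m) → E j) :=
  piKernel (fun i : Fin n => M.noise.comap (fun θ : 𝓕 × (ℕ → 𝒰) => (θ.1, θ.2 (i : ℕ)))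
    (by fun_prop))

instance (M : BayesianSCM 𝓕 𝒰 X E) (n : ℕ) : IsMarkovKernel (M.noiseLaw n) :=
  inferInstanceAs (IsMarkovKernel (piKernel _))

/-- The data set `V*` of `n` instances generated by `(F*, U*)` from the noise `e`; it has law
`P(V | F*, U*)` when `e` has law `M.noiseLaw n (F*, U*)`. -/
def simulate (M : BayesianSCM 𝓕 𝒰 X E) {n : ℕ} (θ : 𝓕 × (ℕ → 𝒰))
    (e : Fin n → (j : Fin m) → E j) : Fin n → (j : Fin m) → X j :=
  fun i => M.observe θ.1 (θ.2 i) (e i)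

/-- The rule `opt` returns a maximizer of the objective on (almost) every data set, for each
number `n ≥ 1` of instances. -/
def IsArgmax {M : BayesianSCM 𝓕 𝒰 X E} (L : M.Likelihood) (q : CausalQuery X) (lam : ℝ)
    (opt : ParticleRule 𝓕 𝒰 X E) : Prop :=
  ∀ n, 1 ≤ n → ∀ᵐ θ ∂M.prior, ∀ᵐ e ∂M.noiseLaw n θ,
    ∀ P : Particle 𝓕 𝒰 n × Particle 𝓕 𝒰 n,
      objective L q lam P (M.simulate θ e) e ≤
        objective L q lam (opt n (M.simulate θ e) e) (M.simulate θ e) e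

/-- `ΔQ̂` of one simulated data set. -/
def gapHat (M : BayesianSCM 𝓕 𝒰 X E) (q : CausalQuery X) (opt : ParticleRule 𝓕 𝒰 X E) {n : ℕ}
    (θ : 𝓕 × (ℕ → 𝒰)) (e : Fin n → (j : Fin m) → E j) : ℝ :=
  M.effectGap q (opt n (M.simulate θ e) e) e

/-- The expected gap for `n` instances, a function of `(F*, U*)`. -/
def expectedGap (M : BayesianSCM 𝓕 𝒰 X E) (q : CausalQuery X) (opt : ParticleRule 𝓕 𝒰 X E)
    (n : ℕ) (θ : 𝓕 × (ℕ → 𝒰)) : ℝ :=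
  ∫ e, M.gapHat q opt θ e ∂M.noiseLaw n θ

/-- The asymptotic expected gap, a function of `(F*, U*)`. -/
def expectedGapLimit (M : BayesianSCM 𝓕 𝒰 X E) (q : CausalQuery X) (opt : ParticleRule 𝓕 𝒰 X E)
    (θ : 𝓕 × (ℕ → 𝒰)) : ℝ :=
  limUnder atTop (fun n => M.expectedGap q opt n θ)

/-- The law, given `(F*, U*)`, of the noise in `k` independent simulations of `n` instances. -/
def trialLaw (M : BayesianSCM 𝓕 𝒰 X E) (k n : ℕ) :
    Kernel (𝓕 × (ℕ → 𝒰)) (Fin k → Fin n → (j : Fin m) → E j) :=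
  piKernel (fun _ : Fin k => M.noiseLaw n)

instance (M : BayesianSCM 𝓕 𝒰 X E) (k n : ℕ) : IsMarkovKernel (M.trialLaw k n) :=
  inferInstanceAs (IsMarkovKernel (piKernel _))

/-- The law of everything that is drawn in a run of the algorithm: `(F*, U*)` from the prior, then
`k` independent simulations given `(F*, U*)`. -/
def runLaw (M : BayesianSCM 𝓕 𝒰 X E) (k n : ℕ) :
    Measure ((𝓕 × (ℕ → 𝒰)) × (Fin k → Fin n → (j : Fin m) → E j)) :=
  M.prior ⊗ₘ M.trialLaw k n

instance (M : BayesianSCM 𝓕 𝒰 X E) (k n : ℕ) : IsProbabilityMeasure (M.runLaw k n) :=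
  inferInstanceAs (IsProbabilityMeasure (M.prior ⊗ₘ M.trialLaw k n))

/-- The gaps computed in the `k` simulations of a run. -/
def trialGaps (M : BayesianSCM 𝓕 𝒰 X E) (q : CausalQuery X) (opt : ParticleRule 𝓕 𝒰 X E)
    {k n : ℕ} (ω : (𝓕 × (ℕ → 𝒰)) × (Fin k → Fin n → (j : Fin m) → E j)) : Fin k → ℝ :=
  fun i => M.gapHat q opt ω.1 (ω.2 i)

/-- The run `ω` of the algorithm returns TRUE. -/
def ReturnsTrue (M : BayesianSCM 𝓕 𝒰 X E) (q : CausalQuery X) (opt : ParticleRule 𝓕 𝒰 X E)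
    (t p : ℝ) {k n : ℕ} (ω : (𝓕 × (ℕ → 𝒰)) × (Fin k → Fin n → (j : Fin m) → E j)) : Prop :=
  testValue t (M.trialGaps q opt ω) < p

/-- The conditional law of the quantity `g (F*, U*)` given the `k` gaps that a run computed. -/
def lawGivenTrials (M : BayesianSCM 𝓕 𝒰 X E) (q : CausalQuery X) (opt : ParticleRule 𝓕 𝒰 X E)
    (k n : ℕ) (g : 𝓕 × (ℕ → 𝒰) → ℝ) : Kernel (Fin k → ℝ) ℝ :=
  condDistrib (fun ω => g ω.1) (M.trialGaps q opt) (M.runLaw k n)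

/-- Given the computed gaps `D`, the error `sampleMean D - 𝔼ₙ` of the sample mean has the normal law
`N(0, std² / k)`, up to an error in the distribution functions that is less than `δ`. -/
def CLTGivenTrials (M : BayesianSCM 𝓕 𝒰 X E) (q : CausalQuery X) (opt : ParticleRule 𝓕 𝒰 X E)
    {k : ℕ} (n : ℕ) (D : Fin k → ℝ) (δ : ℝ) : Prop :=
  ∀ x : ℝ,
    |(M.lawGivenTrials q opt k n (M.expectedGap q opt n) D).real {a | sampleMean D - a < x} -
      (gaussianReal 0 (sampleVariance D / k).toNNReal).real (Set.Iio x)| < δ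

/-- Over the `k` independent simulations from `(F*, U*) = θ`, the studentized sample mean
`(mean - 𝔼ₙ) √k / std` has the standard normal law, up to an error in the distribution functions
that is less than `δ`. -/
def CLTOverTrials (M : BayesianSCM 𝓕 𝒰 X E) (q : CausalQuery X) (opt : ParticleRule 𝓕 𝒰 X E)
    (k n : ℕ) (θ : 𝓕 × (ℕ → 𝒰)) (δ : ℝ) : Prop :=
  ∀ x : ℝ,
    |(M.trialLaw k n θ).real
        {e | (sampleMean (M.trialGaps q opt (θ, e)) - M.expectedGap q opt n θ) * √(k : ℝ) ≤
          x * sampleStd (M.trialGaps q opt (θ, e))} - stdNormalCDF x| < δ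

end BayesianSCM

end

/-! Each normal approximation is used at a single point, and `E_∞ ≤ E_n` does the rest. Given the
trials, `τ` is the mass of `(-∞, μ̂ - t)` under `N(0, σ̂²/k)`
(`gaussianReal_real_Iio_eq_testValue`), while `μ̂ - E_n < μ̂ - t` says `E_n > t`. At `x = μ̂ - t`
the hypothesis therefore gives `P(E_n > t | D) < τ + (p - τ) = p`, and `condDistrib_Ioi_mono` passes
this bound down to `E_∞`. Over repeated trials, let `Φ z = p`. If `E_∞ > t` then `E_n > t`, so
returning TRUE forces the mean studentized around `E_n` to be at most `z`
(`centered_le_of_testValue_lt`), an event of probability less than `p + δ`. -/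

lemma stdNormalCDF_mono : Monotone stdNormalCDF := monotone_cdf _

/-- The jump of a distribution function at `x` is the mass of `{x}`, and the Gaussian has no atoms.
Continuity serves to attain the level `p` exactly. -/
lemma continuous_stdNormalCDF : Continuous stdNormalCDF := by
  rw [continuous_iff_continuousAt]
  intro x
  change ContinuousAt (cdf (gaussianReal 0 1)) x
  have : NullSingletonClass (gaussianReal 0 1) := nullSingletonClass_gaussianReal one_ne_zero
  rw [(monotone_cdf _).continuousAt_iff_leftLim_eq_rightLim, StieltjesFunction.rightLim_eq]
  refine le_antisymm ((monotone_cdf _).leftLim_le le_rfl) ?_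
  have h := (cdf (gaussianReal 0 1)).measure_singleton x
  rw [measure_cdf, measure_singleton] at h
  linarith [ENNReal.ofReal_eq_zero.1 h.symm]

lemma exists_stdNormalCDF_eq {p : ℝ} (hp0 : 0 < p) (hp1 : p < 1) : ∃ z, stdNormalCDF z = p := by
  refine mem_range_of_exists_le_of_exists_ge continuous_stdNormalCDF ?_ ?_
  · exact ((tendsto_cdf_atBot (gaussianReal 0 1)).eventually_le_const hp0).exists
  · exact ((tendsto_cdf_atTop (gaussianReal 0 1)).eventually_const_le hp1).exists

lemma sampleVariance_nonneg {k : ℕ} (hk : 1 ≤ k) (D : Fin k → ℝ) : 0 ≤ sampleVariance D := by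
  have : (0 : ℝ) ≤ (k : ℝ) - 1 := sub_nonneg.2 (by exact_mod_cast hk)
  unfold sampleVariance
  positivity

/-- The distribution function of the centred normal law with standard deviation `s > 0`, expressed
by the standard normal law. -/
lemma gaussianReal_real_Iio {s : ℝ} (hs : 0 < s) (x : ℝ) :
    (gaussianReal 0 (s ^ 2).toNNReal).real (Set.Iio x) = stdNormalCDF (x / s) := by
  have h := gaussianReal_map_const_mul (μ := 0) (v := 1) s
  have hv : NNReal.mk (s ^ 2) (sq_nonneg s) * 1 = (s ^ 2).toNNReal := by
    rw [mul_one]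
    exact (Real.toNNReal_of_nonneg _).symm
  rw [hv, mul_zero] at h
  have : NullSingletonClass (gaussianReal 0 1) := nullSingletonClass_gaussianReal one_ne_zero
  -- The open half-line may replace the closed one of `cdf` because there are no atoms.
  rw [← h, map_measureReal_apply (by fun_prop) measurableSet_Iio, stdNormalCDF, cdf_eq_real,
    measureReal_def, measureReal_def, ← measure_congr (Iio_ae_eq_Iic (a := x / s))]
  congr 2
  ext y
  simp [lt_div_iff₀ hs, mul_comm]

/-- The test value is the mass that the normal law `N(0, std² / k)` gives to `(-∞, mean - t)`. -/
lemma gaussianReal_real_Iio_eq_testValue {k : ℕ} (hk : 1 ≤ k) (t : ℝ) (D : Fin k → ℝ) :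
    (gaussianReal 0 (sampleVariance D / k).toNNReal).real (Set.Iio (sampleMean D - t)) =
      testValue t D := by
  have hk0 : (0 : ℝ) < k := by exact_mod_cast hk
  have hv := sampleVariance_nonneg hk D
  unfold testValue
  -- If the deviation is zero, the normal law is the point mass at `0`, which gives `(-∞, μ̂ - t)`
  -- mass `1` or `0` according to whether `t < μ̂`.
  split_ifs with h h'
  · rw [sampleStd, Real.sqrt_eq_zero hv] at h
    simp [h, Measure.real, h']
  · rw [sampleStd, Real.sqrt_eq_zero hv] at h
    simp [h, Measure.real, h']
  · have hs : 0 < sampleStd D := lt_of_le_of_ne (Real.sqrt_nonneg _) (Ne.symm h)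
    have hsk : 0 < √(k : ℝ) := Real.sqrt_pos.2 hk0
    have hsq : sampleVariance D / k = (sampleStd D / √(k : ℝ)) ^ 2 := by
      rw [div_pow, Real.sq_sqrt hk0.le, sampleStd, Real.sq_sqrt hv]
    rw [hsq, gaussianReal_real_Iio (by positivity)]
    congr 1
    field_simp

/-- A test value below `p = Φ z` forces the mean, centred at any point above `t`, to be at most
`z` standard errors. -/
lemma centered_le_of_testValue_lt {k : ℕ} {t c p z : ℝ} (hp1 : p ≤ 1)
    (hz : stdNormalCDF z = p) (hc : t ≤ c) {D : Fin k → ℝ} (h : testValue t D < p) :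
    (sampleMean D - c) * √(k : ℝ) ≤ z * sampleStd D := by
  have hsk : 0 ≤ √(k : ℝ) := Real.sqrt_nonneg _
  unfold testValue at h
  split_ifs at h with h0 ht
  · exact absurd h hp1.not_gt
  -- Zero deviation and `μ̂ ≤ t ≤ c`: the inequality, stated without division, still holds.
  · rw [h0, mul_zero]
    exact mul_nonpos_of_nonpos_of_nonneg (by linarith) hsk
  · have hs : 0 < sampleStd D := lt_of_le_of_ne (Real.sqrt_nonneg _) (Ne.symm h0)
    rw [← hz] at h
    have h1 := (div_lt_iff₀ hs).1 (stdNormalCDF_mono.reflect_lt h)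
    exact (mul_le_mul_of_nonneg_right (by linarith) hsk).trans h1.le

/-- Disintegration of the joint law of `(T, Y)`, evaluated on the rectangle `b ×ˢ s`. -/
lemma setLIntegral_map_condDistrib {α β Ω : Type*} [MeasurableSpace α] [MeasurableSpace β]
    [MeasurableSpace Ω] [StandardBorelSpace Ω] [Nonempty Ω] {μ : Measure α} [IsFiniteMeasure μ]
    {T : α → β} {Y : α → Ω} (hT : AEMeasurable T μ) (hY : AEMeasurable Y μ) {b : Set β}
    (hb : MeasurableSet b) {s : Set Ω} (hs : MeasurableSet s) :
    ∫⁻ x in b, condDistrib Y T μ x s ∂μ.map T = μ (T ⁻¹' b ∩ Y ⁻¹' s) := by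
  rw [← Measure.compProd_apply_prod hb hs, compProd_map_condDistrib hY,
    Measure.map_apply_of_aemeasurable (hT.prodMk hY) (hb.prod hs), Set.mk_preimage_prod]

/-- Conditional laws inherit the stochastic order from an almost sure inequality. -/
lemma condDistrib_Ioi_mono {α β : Type*} [MeasurableSpace α] [MeasurableSpace β]
    {μ : Measure α} [IsFiniteMeasure μ] {T : α → β} {Y Z : α → ℝ} (hT : AEMeasurable T μ)
    (hY : AEMeasurable Y μ) (hZ : AEMeasurable Z μ) (hYZ : Y ≤ᵐ[μ] Z) (t : ℝ) :
    ∀ᵐ x ∂μ.map T, condDistrib Y T μ x (Set.Ioi t) ≤ condDistrib Z T μ x (Set.Ioi t) := by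
  -- It suffices to compare integrals over events of `T`; these are joint probabilities, and `Y > t`
  -- implies `Z > t` almost surely.
  refine ae_le_of_forall_setLIntegral_le_of_sigmaFinite
    (Kernel.measurable_coe _ measurableSet_Ioi) fun b hb _ => ?_
  rw [setLIntegral_map_condDistrib hT hY hb measurableSet_Ioi,
    setLIntegral_map_condDistrib hT hZ hb measurableSet_Ioi]
  refine measure_mono_ae ?_
  filter_upwards [hYZ] with a ha h
  exact ⟨h.1, lt_of_lt_of_le h.2 ha⟩

namespace BayesianSCM

variable {m : ℕ} {𝓕 𝒰 : Type*} {X E : Fin m → Type*}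
  [MeasurableSpace 𝓕] [MeasurableSpace 𝒰] [∀ j, MeasurableSpace (X j)]
  [∀ j, MeasurableSpace (E j)] {M : BayesianSCM 𝓕 𝒰 X E} {q : CausalQuery X}
  {opt : ParticleRule 𝓕 𝒰 X E}

lemma measurable_expectedGap {N : ℕ}
    (h : Measurable (fun ω : (𝓕 × (ℕ → 𝒰)) × (Fin N → (j : Fin m) → E j) =>
      M.gapHat q opt ω.1 ω.2)) : Measurable (M.expectedGap q opt N) :=
  (h.stronglyMeasurable.integral_kernel_prod_right' (κ := M.noiseLaw N)).measurable

lemma aemeasurable_expectedGapLimit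
    (hmeas : ∀ N, 1 ≤ N → Measurable (fun ω : (𝓕 × (ℕ → 𝒰)) × (Fin N → (j : Fin m) → E j) =>
      M.gapHat q opt ω.1 ω.2))
    (hlim : ∀ᵐ θ ∂M.prior, ∃ l : ℝ, Tendsto (fun N => M.expectedGap q opt N θ) atTop (𝓝 l)) :
    AEMeasurable (M.expectedGapLimit q opt) M.prior := by
  -- The shift avoids `N = 0`, where measurability is not assumed.
  refine aemeasurable_of_tendsto_metrizable_ae atTop (f := fun N => M.expectedGap q opt (N + 1))
    (fun N => (measurable_expectedGap (hmeas _ N.succ_pos)).aemeasurable) ?_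
  filter_upwards [hlim] with θ hθ
  exact (tendsto_add_atTop_iff_nat 1).2 (tendsto_nhds_limUnder hθ)

lemma measurable_trialGaps {k n : ℕ}
    (h : Measurable (fun ω : (𝓕 × (ℕ → 𝒰)) × (Fin n → (j : Fin m) → E j) =>
      M.gapHat q opt ω.1 ω.2)) : Measurable (M.trialGaps q opt (k := k) (n := n)) :=
  measurable_pi_lambda _ fun i =>
    h.comp (measurable_fst.prodMk ((measurable_pi_apply i).comp measurable_snd))

/-- The trial kernel is Markov, so the first marginal of a run is the prior; this transfers
prior-almost-sure facts to runs. -/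
lemma quasiMeasurePreserving_fst_runLaw (M : BayesianSCM 𝓕 𝒰 X E) (k n : ℕ) :
    Measure.QuasiMeasurePreserving Prod.fst (M.runLaw k n) M.prior := by
  refine ⟨measurable_fst, ?_⟩
  rw [← Measure.fst, runLaw, Measure.fst_compProd]

end BayesianSCM

theorem theorem4p4 {m : ℕ} {𝓕 𝒰 : Type*} {X E : Fin m → Type*}
    [MeasurableSpace 𝓕] [MeasurableSpace 𝒰] [∀ j, MeasurableSpace (X j)]
    [∀ j, MeasurableSpace (E j)]
    -- the inputs of the algorithm: prior, causal estimand and interventions, hyperparameters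
    (M : BayesianSCM 𝓕 𝒰 X E) (L : M.Likelihood) (q : CausalQuery X)
    (n k : ℕ) (hn : 1 ≤ n) (hk : 2 ≤ k) (lam t p : ℝ) (hp0 : 0 < p) (hp1 : p < 1)
    -- the maximizers chosen by the algorithm
    (opt : ParticleRule 𝓕 𝒰 X E) (hopt : BayesianSCM.IsArgmax L q lam opt)
    -- the expected gaps and their limit are well defined
    (hmeas : ∀ N, 1 ≤ N → Measurable (fun ω : (𝓕 × (ℕ → 𝒰)) × (Fin N → (j : Fin m) → E j) =>
      M.gapHat q opt ω.1 ω.2))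
    (hint : ∀ᵐ θ ∂M.prior, ∀ N, 1 ≤ N →
      Integrable (fun e : Fin N → (j : Fin m) → E j => M.gapHat q opt θ e) (M.noiseLaw N θ))
    (hlim : ∀ᵐ θ ∂M.prior, ∃ l : ℝ, Tendsto (fun N => M.expectedGap q opt N θ) atTop (𝓝 l))
    -- the expected gap is never smaller than the asymptotic one
    (hmono : ∀ᵐ θ ∂M.prior, ∀ N, 1 ≤ N →
      M.expectedGapLimit q opt θ ≤ M.expectedGap q opt N θ) :
    -- given the simulations of a run that returns TRUE
    (∀ᵐ ω ∂M.runLaw k n, M.ReturnsTrue q opt t p ω →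
      M.CLTGivenTrials q opt n (M.trialGaps q opt ω) (p - testValue t (M.trialGaps q opt ω)) →
      (M.lawGivenTrials q opt k n (M.expectedGapLimit q opt) (M.trialGaps q opt ω)).real
        (Set.Ioi t) < p) ∧
    -- over repeated simulations from fixed `(F*, U*)`
    (∀ᵐ θ ∂M.prior, t < M.expectedGapLimit q opt θ → ∀ δ : ℝ, M.CLTOverTrials q opt k n θ δ →
      (M.trialLaw k n θ).real {e | M.ReturnsTrue q opt t p (θ, e)} < p + δ) := by
  have hEn := BayesianSCM.measurable_expectedGap (hmeas n hn)
  have hEl := BayesianSCM.aemeasurable_expectedGapLimit hmeas hlim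
  have hT := BayesianSCM.measurable_trialGaps (k := k) (hmeas n hn)
  have hfst := M.quasiMeasurePreserving_fst_runLaw k n
  have hk1 : 1 ≤ k := by omega
  constructor
  · have hle := condDistrib_Ioi_mono hT.aemeasurable (hEl.comp_quasiMeasurePreserving hfst)
      (hEn.aemeasurable.comp_quasiMeasurePreserving hfst)
      (hfst.ae (hmono.mono fun θ h => h n hn)) t
    filter_upwards [ae_of_ae_map hT.aemeasurable hle] with ω hω _ hclt
    -- At this point the error event becomes `E_n > t` and the normal mass becomes `τ`.
    have h1 := hclt (sampleMean (M.trialGaps q opt ω) - t)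
    rw [gaussianReal_real_Iio_eq_testValue hk1] at h1
    have hset : {a : ℝ | sampleMean (M.trialGaps q opt ω) - a <
        sampleMean (M.trialGaps q opt ω) - t} = Set.Ioi t := by
      ext a
      simp
    rw [hset] at h1
    have h2 : (M.lawGivenTrials q opt k n (M.expectedGapLimit q opt)
        (M.trialGaps q opt ω)).real (Set.Ioi t) ≤
        (M.lawGivenTrials q opt k n (M.expectedGap q opt n)
          (M.trialGaps q opt ω)).real (Set.Ioi t) := by
      unfold BayesianSCM.lawGivenTrials
      exact ENNReal.toReal_mono (measure_ne_top _ _) hω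
    linarith [(abs_lt.1 h1).2]
  · obtain ⟨z, hz⟩ := exists_stdNormalCDF_eq hp0 hp1
    filter_upwards [hmono] with θ hθ ht δ hclt
    -- The approximation is needed only at the `p`-quantile `z`.
    have h1 := (abs_lt.1 (hclt z)).2
    rw [hz] at h1
    have h2 : (M.trialLaw k n θ).real {e | M.ReturnsTrue q opt t p (θ, e)} ≤
        (M.trialLaw k n θ).real
          {e | (sampleMean (M.trialGaps q opt (θ, e)) - M.expectedGap q opt n θ) * √(k : ℝ) ≤
            z * sampleStd (M.trialGaps q opt (θ, e))} :=
      measureReal_mono fun e he =>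
        centered_le_of_testValue_lt hp1.le hz (ht.le.trans (hθ n hn)) he
    linarith
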